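/- **Rossi's bound.** Let $(R,\mathfrak m)$ be a $2$-dimensional (Noetherian) Cohen–Macaulay local ring with infinite residue field, let $I$ be an $\mathfrak m$-primary ideal of $R$, and let $J$ be a minimal reduction of $I$; that is, $J\subseteq I$ is minimal with respect to inclusion among the ideals contained in $I$ for which $I^{n+1}=JI^{n}$ for some $n\ge 0$. Let $\lambda$ denote length, and let $e_0(I),e_1(I),e_2(I)$ be the Hilbert coefficients of $I$, that is, the unique integers such that $$\lambda(R/I^n)=e_0(I)\binom{n+1}{2}-e_1(I)\,n+e_2(I)\qquad\text{for all } n\gg 0$$ (such integers exist). Let $r_J(I)=\min\{n\ge 0 : I^{n+1}=JI^{n}\}$ be the reduction number of $I$ with respect to $J$. Then $$r_J(I)\le e_1(I)-e_0(I)+\lambda(R/I)+1 .$$ -/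

import Mathlib

open Filter

namespace RossiBound

section Definitions

variable {R : Type*} [CommRing R]

/-- The depth of a local ring: the supremum of the lengths of the regular sequences on `R`
contained in the maximal ideal. -/
noncomputable def depth (R : Type*) [CommRing R] [IsLocalRing R] : ℕ∞ :=
  ⨆ rs : {rs : List R // RingTheory.Sequence.IsRegular R rs ∧
    ∀ r ∈ rs, r ∈ IsLocalRing.maximalIdeal R}, (rs.1.length : ℕ∞)

/-- A Noetherian local ring is Cohen–Macaulay if its depth equals its Krull dimension. -/
class IsCohenMacaulayLocalRing (R : Type*) [CommRing R] [IsLocalRing R] : Prop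
    extends IsNoetherianRing R where
  depth_eq_dim : ((depth R : ℕ∞) : WithBot ℕ∞) = ringKrullDim R

/-- `I` is primary to the maximal ideal. -/
def IsMPrimary [IsLocalRing R] (I : Ideal R) : Prop :=
  I.IsPrimary ∧ I.radical = IsLocalRing.maximalIdeal R

/-- The length of `R ⧸ I` as a natural number (used only where it is finite, see
`IsMPrimary.length_ne_top` and `IsMPrimary.pow`). -/
noncomputable def colength (I : Ideal R) : ℕ := (Module.length R (R ⧸ I)).toNat

/-- `J` is a reduction of `I`. -/
def IsReduction (J I : Ideal R) : Prop :=
  J ≤ I ∧ ∃ n : ℕ, I ^ (n + 1) = J * I ^ n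

/-- `J` is a minimal reduction of `I`: minimal for inclusion among the reductions of `I`. -/
def IsMinimalReduction (J I : Ideal R) : Prop :=
  Minimal (fun L : Ideal R => IsReduction L I) J

/-- The reduction number `r_J(I) = min {n | I ^ (n + 1) = J I ^ n}`; the set is nonempty as soon
as `J` is a reduction of `I`. -/
noncomputable def reductionNumber (J I : Ideal R) : ℕ :=
  sInf {n : ℕ | I ^ (n + 1) = J * I ^ n}

/-- The integer `∑_{i ≤ d} (-1)^i e_i * binom (n + d - 1 - i) (d - i)`. The truncated subtraction
is the true one for `n ≥ 1`. -/
def hilbertSum (d : ℕ) (e : Fin (d + 1) → ℤ) (n : ℕ) : ℤ :=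
  ∑ i : Fin (d + 1), (-1) ^ (i : ℕ) * e i * ((n + d - 1 - i).choose (d - i) : ℤ)

/-- `e₀, …, e_d` are the coefficients of the Hilbert polynomial of `I` in dimension `d`: for all
large `n` the length of `R ⧸ I ^ n` is finite and equals
`e₀ binom(n+d-1, d) - e₁ binom(n+d-2, d-1) + ⋯ + (-1)^d e_d`. -/
def IsHilbertCoeffs (I : Ideal R) (d : ℕ) (e : Fin (d + 1) → ℤ) : Prop :=
  ∀ᶠ n : ℕ in atTop, Module.length R (R ⧸ I ^ n) ≠ ⊤ ∧ (colength (I ^ n) : ℤ) = hilbertSum d e n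

open Classical in
/-- The Hilbert coefficients `e_i(I)` in dimension `d` (zero by convention if there is no Hilbert
polynomial; they are unique by `IsHilbertCoeffs.unique`). -/
noncomputable def hilbertCoeff (I : Ideal R) (d : ℕ) : Fin (d + 1) → ℤ :=
  if h : ∃ e, IsHilbertCoeffs I d e then h.choose else 0

end Definitions

section Basic

variable {R : Type*} [CommRing R]

theorem IsMPrimary.length_ne_top [IsLocalRing R] [IsNoetherianRing R] {I : Ideal R}
    (hI : IsMPrimary I) : Module.length R (R ⧸ I) ≠ ⊤ := by
  have h : IsArtinianRing (R ⧸ I) := by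
    rw [isArtinianRing_iff_isNoetherianRing_krullDimLE_zero]
    refine ⟨inferInstance, ?_⟩
    refine Ring.KrullDimLE.mk₀ fun P hP => ?_
    have h1 : (P.comap (Ideal.Quotient.mk I)) = IsLocalRing.maximalIdeal R := by
      refine le_antisymm (IsLocalRing.le_maximalIdeal (Ideal.comap_ne_top _ hP.ne_top)) ?_
      rw [← hI.2]
      have := Ideal.IsPrime.comap (Ideal.Quotient.mk I) (K := P)
      refine (Ideal.IsPrime.radical_le_iff this).2 fun x hx => ?_
      rw [Ideal.mem_comap, Ideal.Quotient.eq_zero_iff_mem.2 hx]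
      exact P.zero_mem
    have h2 : (P.comap (Ideal.Quotient.mk I)).IsMaximal := h1 ▸ inferInstance
    have := Ideal.map_comap_of_surjective _ (Ideal.Quotient.mk_surjective (I := I)) P
    rw [← this]
    refine (Ideal.map_eq_top_or_isMaximal_of_surjective _
      Ideal.Quotient.mk_surjective h2).resolve_left ?_
    rw [this]
    exact hP.ne_top
  rw [Module.length_eq_of_surjective (S := R) (R := R ⧸ I) (M := R ⧸ I)
    Ideal.Quotient.mk_surjective]
  exact Module.length_ne_top

theorem IsMPrimary.pow [IsLocalRing R] {I : Ideal R} (hI : IsMPrimary I) {n : ℕ} (hn : n ≠ 0) :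
    IsMPrimary (I ^ n) := by
  have h : (I ^ n).radical = IsLocalRing.maximalIdeal R := by
    rw [Ideal.radical_pow I hn, hI.2]
  refine ⟨Ideal.isPrimary_of_isMaximal_radical (h ▸ inferInstance), h⟩

theorem hilbertSum_sub (d : ℕ) (e : Fin (d + 2) → ℤ) (n : ℕ) :
    hilbertSum (d + 1) e (n + 1) - hilbertSum (d + 1) e n =
      hilbertSum d (fun i => e i.castSucc) (n + 1) := by
  unfold hilbertSum
  rw [Fin.sum_univ_castSucc (n := d + 1), Fin.sum_univ_castSucc (n := d + 1)]
  simp only [Fin.val_last, Nat.sub_self, Nat.choose_zero_right, add_sub_add_right_eq_sub]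
  rw [← Finset.sum_sub_distrib]
  refine Finset.sum_congr rfl fun i _ => ?_
  have hi : (i : ℕ) ≤ d := Nat.lt_succ_iff.1 i.2
  obtain ⟨k, hk⟩ := Nat.exists_eq_add_of_le hi
  have h1 : n + 1 + (d + 1) - 1 - (i.castSucc : ℕ) = (n + k) + 1 := by
    simp only [Fin.val_castSucc]; omega
  have h2 : n + (d + 1) - 1 - (i.castSucc : ℕ) = n + k := by
    simp only [Fin.val_castSucc]; omega
  have h3 : d + 1 - (i.castSucc : ℕ) = k + 1 := by
    simp only [Fin.val_castSucc]; omega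
  have h4 : n + 1 + d - 1 - (i : ℕ) = n + k := by omega
  have h5 : d - (i : ℕ) = k := by omega
  rw [h1, h2, h3, h4, h5, Nat.choose_succ_succ]
  push_cast
  simp only [Fin.val_castSucc]
  ring

theorem hilbertSum_injective (d : ℕ) : ∀ e e' : Fin (d + 1) → ℤ,
    (∀ᶠ n in atTop, hilbertSum d e n = hilbertSum d e' n) → e = e' := by
  induction d with
  | zero =>
    intro e e' h
    obtain ⟨n, hn⟩ := h.exists
    funext i
    have : i = 0 := Fin.eq_zero i
    subst this
    simpa [hilbertSum] using hn
  | succ d ih =>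
    intro e e' h
    have hs : (fun i : Fin (d + 1) => e i.castSucc) = fun i => e' i.castSucc := by
      apply ih
      obtain ⟨N, hN⟩ := eventually_atTop.1 h
      refine eventually_atTop.2 ⟨N + 1, fun n hn => ?_⟩
      obtain ⟨m, rfl⟩ : ∃ m, n = m + 1 := ⟨n - 1, by omega⟩
      rw [← hilbertSum_sub, ← hilbertSum_sub, hN _ (by omega), hN _ (by omega)]
    obtain ⟨n, hn⟩ := h.exists
    have hl : e (Fin.last _) = e' (Fin.last _) := by
      unfold hilbertSum at hn
      rw [Fin.sum_univ_castSucc (n := d + 1), Fin.sum_univ_castSucc (n := d + 1)] at hn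
      have hs' : ∀ i : Fin (d + 1), e i.castSucc = e' i.castSucc := congrFun hs
      simp only [hs'] at hn
      simpa only [add_right_inj, Fin.val_last, Nat.sub_self, Nat.choose_zero_right, Nat.cast_one,
        mul_one, mul_eq_mul_left_iff, pow_eq_zero_iff', neg_eq_zero, one_ne_zero, false_and,
        or_false] using hn
    funext i
    refine Fin.lastCases hl (fun j => congrFun hs j) i

/-- The Hilbert coefficients are unique. -/
theorem IsHilbertCoeffs.unique {I : Ideal R} {d : ℕ} {e e' : Fin (d + 1) → ℤ}
    (h : IsHilbertCoeffs I d e) (h' : IsHilbertCoeffs I d e') : e = e' := by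
  apply hilbertSum_injective
  filter_upwards [h, h'] with n hn hn'
  rw [← hn.2, ← hn'.2]

theorem IsHilbertCoeffs.hilbertCoeff_eq {I : Ideal R} {d : ℕ} {e : Fin (d + 1) → ℤ}
    (h : IsHilbertCoeffs I d e) : hilbertCoeff I d = e := by
  have hex : ∃ e, IsHilbertCoeffs I d e := ⟨e, h⟩
  unfold hilbertCoeff
  rw [dif_pos hex]
  exact hex.choose_spec.unique h

end Basic

end RossiBound

/-! The residue field being infinite, a minimal reduction is `J = (x, y)` with `x, y` a regular
sequence and `x` superficial for `I` (`IsMinimalReduction.exists_generators`). Replace the powers of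
`I` by the filtration `F n = ⋃ₖ (I ^ (n + k) : x ^ k)`. It equals `I ^ n` for large `n`, so it has
the same Hilbert polynomial, and `F (n + 1) : x = F n` holds in every degree.

Put `w n = λ(F (n + 1) / J F n)`. By `length_quotient_span_pair_mul` the second differences of `λ(R
/ F n)` are `λ(R / J) - w n`; summing twice gives `e₀ = λ(R / J)` and `e₁ = ∑ w n`.

Let `s` be least with `I ^ (s + 1) ⊆ J F s`. Over the Rees algebra of `J`, modulo that of `I`, the
module `⨁ F n` has `g ≤ ∑ λ(F (n + 1) / (I ^ (n + 1) + J F n))` generators. A graded determinant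
trick (`pow_succ_eq_mul_pow_of_generators`) then gives `r_J(I) ≤ s + g`.

Finally `w n = λ(F (n + 1) / (I ^ (n + 1) + J F n)) + λ((I ^ (n + 1) + J F n) / J F n)`. The last
term is `λ(I / J) = e₀ - λ(R / I)` for `n = 0` and at least `1` for `0 < n < s`. Hence `e₁ ≥ g + e₀
- λ(R / I) + s - 1`, which is the bound. -/

namespace RossiBound

/-! ### Existence of superficial nonzerodivisors, by prime avoidance in the Rees algebra. -/

section Superficial

open Polynomial

/-- Finitely many ideals none of which contains `J` do not cover `J`, provided that the ring has
infinitely many elements whose differences are units. -/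
theorem exists_mem_forall_notMem_of_isUnit_sub {R : Type*} [CommRing R] {u : ℕ → R}
    (hu : ∀ i j, i ≠ j → IsUnit (u i - u j)) (J : Ideal R) {S : Set (Ideal R)} (hS : S.Finite)
    (hJ : ∀ V ∈ S, ¬ J ≤ V) : ∃ x ∈ J, ∀ V ∈ S, x ∉ V := by
  induction S, hS using Set.Finite.induction_on with
  | empty => exact ⟨0, J.zero_mem, by simp⟩
  | @insert V S _ hS ih =>
    obtain ⟨x, hxJ, hx⟩ := ih fun W hW => hJ W (Set.mem_insert_of_mem _ hW)
    obtain ⟨y, hyJ, hy⟩ := Set.not_subset.1 (hJ V (Set.mem_insert _ _))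
    -- On the line `x + u i * y` each ideal contains at most one point: two points would put `y`,
    -- and then `x`, into it.
    have key : ∀ W ∈ insert V S, {i | x + u i * y ∈ W}.Finite := by
      intro W hW
      refine Set.Subsingleton.finite fun i hi j hj => by_contra fun hij => ?_
      have hyW : y ∈ W := by
        have h := W.sub_mem hi hj
        rw [show x + u i * y - (x + u j * y) = (u i - u j) * y by ring] at h
        exact (Ideal.unit_mul_mem_iff_mem W (hu i j hij)).1 h
      rcases hW with rfl | hW
      · exact hy hyW
      · refine hx W hW ?_
        simpa using W.sub_mem hi (W.mul_mem_left (u i) hyW)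
    obtain ⟨i, hi⟩ := ((hS.insert V).biUnion key).exists_notMem
    refine ⟨x + u i * y, J.add_mem hxJ (J.mul_mem_left _ hyJ), fun W hW h => hi ?_⟩
    exact Set.mem_biUnion hW h

variable {R : Type*} [CommRing R]

/-- The ideal of the Rees algebra of `I` formed by the polynomials `∑ aₙ tⁿ` with
`aₙ I ^ k ⊆ I ^ (n + k + 1)`. -/
def reesTorsion (I : Ideal R) (k : ℕ) : Ideal (reesAlgebra I) where
  carrier := {p | ∀ n, ∀ c ∈ I ^ k, p.1.coeff n * c ∈ I ^ (n + k + 1)}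
  zero_mem' n c _ := by simp
  add_mem' hp hq n c hc := by
    simpa [add_mul] using add_mem (hp n c hc) (hq n c hc)
  smul_mem' q p hp n c hc := by
    simp only [smul_eq_mul, MulMemClass.coe_mul, coeff_mul, Finset.sum_mul]
    refine Ideal.sum_mem _ fun ij hij => ?_
    rw [← Finset.HasAntidiagonal.mem_antidiagonal.1 hij, mul_assoc,
      show ij.1 + ij.2 + k + 1 = ij.1 + (ij.2 + k + 1) by omega, pow_add]
    exact Ideal.mul_mem_mul (q.2 _) (hp _ c hc)

theorem mem_reesTorsion {I : Ideal R} {k : ℕ} {p : reesAlgebra I} :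
    p ∈ reesTorsion I k ↔ ∀ n, ∀ c ∈ I ^ k, p.1.coeff n * c ∈ I ^ (n + k + 1) := Iff.rfl

theorem reesTorsion_mono (I : Ideal R) : Monotone (reesTorsion I) := by
  refine monotone_nat_of_le_succ fun k p hp => ?_
  rw [mem_reesTorsion] at hp ⊢
  intro n c hc
  rw [pow_succ] at hc
  refine Submodule.mul_induction_on hc (fun a ha b hb => ?_) fun a b ha hb => ?_
  · rw [← mul_assoc, show n + (k + 1) + 1 = n + k + 1 + 1 by ring, pow_succ]
    exact Ideal.mul_mem_mul (hp n a ha) hb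
  · rw [mul_add]
    exact add_mem ha hb

/-- The element `a tⁿ` of the Rees algebra. -/
noncomputable def reesMonomial {I : Ideal R} (n : ℕ) (a : R) (ha : a ∈ I ^ n) : reesAlgebra I :=
  ⟨monomial n a, reesAlgebra.monomial_mem.2 ha⟩

/-- Once the chain `reesTorsion I k` is stationary with value `T`, this shows that no nonzero class
modulo `T` is killed by all of degree one. Hence no associated prime of the quotient contains the
degree one part. -/
theorem mul_reesMonomial_mem_reesTorsion {I : Ideal R} {k : ℕ} {p : reesAlgebra I}
    (h : ∀ a (ha : a ∈ I ^ 1), reesMonomial 1 a ha * p ∈ reesTorsion I k) :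
    p ∈ reesTorsion I (k + 1) := by
  rw [mem_reesTorsion]
  intro n c hc
  rw [pow_succ] at hc
  refine Submodule.mul_induction_on hc (fun a ha b hb => ?_) fun a b ha hb => ?_
  · have := mem_reesTorsion.1 (h b (by simpa using hb)) (n + 1) a ha
    simp only [reesMonomial, MulMemClass.coe_mul, coeff_monomial_mul] at this
    rw [show n + (k + 1) + 1 = n + 1 + k + 1 by ring]
    convert this using 1
    ring
  · rw [mul_add]
    exact add_mem ha hb

/-- The torsion of the associated graded ring vanishes in large degrees. Far above the degrees of
finitely many generators, every coefficient multiplying a generator has degree at least `k`, so it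
splits off a factor in `I ^ k`, which sends the generator one power of `I` further. -/
theorem exists_mem_pow_of_reesTorsion [IsNoetherianRing R] (I : Ideal R) (k : ℕ) :
    ∃ n₀, ∀ n ≥ n₀, ∀ z ∈ I ^ n, (∀ c ∈ I ^ k, z * c ∈ I ^ (n + k + 1)) → z ∈ I ^ (n + 1) := by
  obtain ⟨G, hG⟩ := IsNoetherian.noetherian (reesTorsion I k)
  refine ⟨G.sup (fun g => g.1.natDegree) + k, fun n hn z hz h => ?_⟩
  have hmem : reesMonomial n z hz ∈ reesTorsion I k := by
    rw [mem_reesTorsion]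
    intro m c hc
    by_cases hm : n = m
    · subst hm
      simpa [reesMonomial] using h c hc
    · simp [reesMonomial, coeff_monomial, hm]
  have hcoeff : ∀ p ∈ reesTorsion I k, p.1.coeff n ∈ I ^ (n + 1) := by
    intro p hp
    rw [← hG] at hp
    obtain ⟨f, -, rfl⟩ := Submodule.mem_span_finset.1 hp
    simp only [smul_eq_mul, AddSubmonoidClass.coe_finsetSum, MulMemClass.coe_mul, finsetSum_coeff,
      coeff_mul]
    refine Ideal.sum_mem _ fun g hg => Ideal.sum_mem _ fun ij hij => ?_
    have hij := Finset.HasAntidiagonal.mem_antidiagonal.1 hij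
    rcases lt_or_ge g.1.natDegree ij.2 with h1 | h1
    · simp [coeff_eq_zero_of_natDegree_lt h1]
    have h2 : g.1.natDegree ≤ G.sup (fun g => g.1.natDegree) :=
      Finset.le_sup (f := fun g : reesAlgebra I => g.1.natDegree) hg
    have hf : (f g).1.coeff ij.1 ∈ I ^ (ij.1 - k) * I ^ k := by
      rw [← pow_add, Nat.sub_add_cancel (by omega)]
      exact (f g).2 _
    have hgT : g ∈ reesTorsion I k := hG ▸ Submodule.subset_span hg
    refine Submodule.mul_induction_on hf (fun a ha b hb => ?_) fun a b ha hb => ?_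
    · rw [show n + 1 = ij.1 - k + (ij.2 + k + 1) by omega, pow_add, mul_assoc, mul_comm b]
      exact Ideal.mul_mem_mul ha (hgT _ b hb)
    · rw [add_mul]
      exact add_mem ha hb
  simpa [reesMonomial] using hcoeff _ hmem

/-- For `a ∈ I` the power `(a t) ^ (r + 1)` lies in the ideal generated by `J t`, because `I ^ (r +
1) = J I ^ r`; a prime containing `J t` therefore contains `a t`. -/
theorem reesMonomial_mem_of_reduction {I J : Ideal R} {r : ℕ}
    (hr : I ^ (r + 1) = J * I ^ r) {Q : Ideal (reesAlgebra I)} [hQ : Q.IsPrime]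
    (hJ : ∀ a ∈ J, ∃ ha : a ∈ I ^ 1, reesMonomial 1 a ha ∈ Q) (a : R) (ha : a ∈ I ^ 1) :
    reesMonomial 1 a ha ∈ Q := by
  have key : ∀ c ∈ J * I ^ r, ∃ hc : c ∈ I ^ (r + 1), reesMonomial (r + 1) c hc ∈ Q := by
    intro c hc
    refine Submodule.mul_induction_on hc (fun b hb d hd => ?_) ?_
    · obtain ⟨hb', hbQ⟩ := hJ b hb
      refine ⟨by rw [hr]; exact Ideal.mul_mem_mul hb hd, ?_⟩
      convert Q.mul_mem_right (reesMonomial r d hd) hbQ using 1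
      ext1
      simp [reesMonomial, monomial_mul_monomial, add_comm]
    · rintro b d ⟨hb, hbQ⟩ ⟨hd, hdQ⟩
      refine ⟨add_mem hb hd, ?_⟩
      convert Q.add_mem hbQ hdQ using 1
      ext1
      simp [reesMonomial]
  have hpow : a ^ (r + 1) ∈ J * I ^ r := by
    rw [← hr]
    exact Ideal.pow_mem_pow (by simpa using ha) _
  obtain ⟨hc, hcQ⟩ := key _ hpow
  refine hQ.mem_of_pow_mem (r + 1) ?_
  convert hcQ using 1
  ext1
  simp [reesMonomial, monomial_pow]

/-- The elements of `I` whose degree one copy in the Rees algebra lies in `Q`. -/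
def reesContraction {I : Ideal R} (Q : Ideal (reesAlgebra I)) : Ideal R where
  carrier := {a | ∃ ha : a ∈ I ^ 1, reesMonomial 1 a ha ∈ Q}
  zero_mem' := ⟨zero_mem _, by convert Q.zero_mem using 1; ext1; simp [reesMonomial]⟩
  add_mem' := by
    rintro a b ⟨ha, haQ⟩ ⟨hb, hbQ⟩
    refine ⟨add_mem ha hb, ?_⟩
    convert Q.add_mem haQ hbQ using 1
    ext1
    simp [reesMonomial]
  smul_mem' := by
    rintro c a ⟨ha, haQ⟩
    refine ⟨Ideal.mul_mem_left _ _ ha, ?_⟩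
    convert Q.mul_mem_left (algebraMap R _ c) haQ using 1
    ext1
    simp [reesMonomial, C_mul_monomial]

theorem eq_zero_of_reduction {I J : Ideal R} {r : ℕ} (hr : I ^ (r + 1) = J * I ^ r)
    (hI : ∀ z, (∀ a ∈ I, a * z = 0) → z = 0) {z : R} (hz : ∀ a ∈ J, a * z = 0) : z = 0 := by
  have hpow : ∀ n, (∀ a ∈ I ^ n, a * z = 0) → z = 0 := by
    intro n
    induction n with
    | zero => intro h; simpa using h 1 (by simp)
    | succ n ih =>
      refine fun h => ih fun a ha => hI _ fun b hb => ?_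
      rw [← mul_assoc, mul_comm b]
      exact h _ (by rw [pow_succ]; exact Ideal.mul_mem_mul ha hb)
  refine hpow (r + 1) fun a ha => ?_
  rw [hr] at ha
  refine Submodule.mul_induction_on ha (fun b hb c hc => ?_) fun b c hb hc => ?_
  · rw [mul_comm b, mul_assoc, hz b hb, mul_zero]
  · rw [add_mul, hb, hc, add_zero]

/-- A nonzerodivisor which is superficial in large degrees for the associated graded ring of `I`
is superficial for `I`. -/
theorem mem_pow_of_mul_mem_pow [IsNoetherianRing R] {I : Ideal R} {x : R}
    (hx : ∀ z, x * z = 0 → z = 0) {n₀ : ℕ}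
    (h : ∀ n ≥ n₀, ∀ z ∈ I ^ n, x * z ∈ I ^ (n + 2) → z ∈ I ^ (n + 1)) :
    ∃ n₁, ∀ n ≥ n₁, ∀ z, x * z ∈ I ^ (n + 1) → z ∈ I ^ n := by
  obtain ⟨k, hk⟩ := Ideal.exists_pow_inf_eq_pow_smul I (Ideal.span {x})
  refine ⟨n₀ + k, fun n hn z hz => ?_⟩
  -- Artin-Rees for `(x)` gives a start in degree `n₀`; the hypothesis `h` then climbs one power at
  -- a time.
  have hz₀ : z ∈ I ^ n₀ := by
    have h1 : x * z ∈ I ^ (n + 1) • (⊤ : Ideal R) ⊓ Ideal.span {x} :=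
      ⟨by simpa using hz, Ideal.mul_mem_right _ _ (Ideal.mem_span_singleton_self x)⟩
    rw [hk _ (by omega)] at h1
    have h2 := Submodule.smul_mono (le_refl (I ^ (n + 1 - k))) inf_le_right h1
    rw [smul_eq_mul, mul_comm, Ideal.mem_span_singleton_mul] at h2
    obtain ⟨w, hw, hwz⟩ := h2
    have : z = w := by
      rw [← sub_eq_zero]
      exact hx _ (by rw [mul_sub, hwz, sub_self])
    rw [this]
    exact Ideal.pow_le_pow_right (by omega) hw
  have : ∀ j ≥ n₀, j ≤ n → z ∈ I ^ j := by
    intro j hj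
    induction j, hj using Nat.le_induction with
    | base => exact fun _ => hz₀
    | succ j hj ih =>
      exact fun hjn => h j hj z (ih (by omega)) (Ideal.pow_le_pow_right (by omega) hz)
  exact this n (by omega) le_rfl

/-- A general element of a reduction `J` of `I` is a nonzerodivisor and is superficial for `I`. -/
theorem exists_superficial [IsNoetherianRing R] {u : ℕ → R}
    (hu : ∀ i j, i ≠ j → IsUnit (u i - u j)) {I J V : Ideal R} {r : ℕ}
    (hIJ : J ≤ I) (hr : I ^ (r + 1) = J * I ^ r)
    (hI : ∀ z, (∀ a ∈ I, a * z = 0) → z = 0) (hV : ¬ J ≤ V) :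
    ∃ x ∈ J, x ∉ V ∧ (∀ z, x * z = 0 → z = 0) ∧
      ∃ n₀, ∀ n ≥ n₀, ∀ z, x * z ∈ I ^ (n + 1) → z ∈ I ^ n := by
  classical
  obtain ⟨k, hk⟩ := monotone_stabilizes_iff_noetherian.2 inferInstance
    (⟨reesTorsion I, reesTorsion_mono I⟩ : ℕ →o Ideal (reesAlgebra I))
  set T := reesTorsion I k with hT
  have hT1 : reesTorsion I (k + 1) = T := (hk (k + 1) (by omega)).symm
  -- Avoiding the associated primes of `R` makes `x` a nonzerodivisor; avoiding the contractions
  -- makes `x t` a nonzerodivisor modulo `T`, which gives superficiality.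
  set S : Set (Ideal R) := insert V (associatedPrimes R R ∪
    reesContraction '' associatedPrimes (reesAlgebra I) (reesAlgebra I ⧸ T)) with hS
  have hSfin : S.Finite := ((associatedPrimes.finite _ _).union
    ((associatedPrimes.finite _ _).image _)).insert _
  have hSJ : ∀ W ∈ S, ¬ J ≤ W := by
    rintro W (rfl | hW | ⟨Q, hQ, rfl⟩) hle
    · exact hV hle
    · obtain ⟨hp, z, rfl⟩ := isAssociatedPrime_iff.1 hW
      have : z = 0 := eq_zero_of_reduction hr hI fun a ha => by
        simpa using hle ha
      simp [this] at hp
      exact hp.ne_top (by simp)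
    · obtain ⟨hp, z, hz⟩ := isAssociatedPrime_iff.1 hQ
      obtain ⟨p, rfl⟩ := Ideal.Quotient.mk_surjective z
      have hmem : ∀ q, q ∈ Q ↔ q * p ∈ T := by
        intro q
        rw [hz, Submodule.mem_colon_singleton, Submodule.mem_bot,
          ← Ideal.Quotient.eq_zero_iff_mem]
        rfl
      have hpT : p ∈ T := by
        rw [← hT1]
        refine mul_reesMonomial_mem_reesTorsion fun a ha => (hmem _).1 ?_
        exact reesMonomial_mem_of_reduction hr (fun b hb => hle hb) a ha
      exact hp.ne_top ((Ideal.eq_top_iff_one _).2 ((hmem 1).2 (by simpa using hpT)))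
  obtain ⟨x, hxJ, hx⟩ := exists_mem_forall_notMem_of_isUnit_sub hu J hSfin hSJ
  have hreg : ∀ z, x * z = 0 → z = 0 := by
    intro z hz
    by_contra hne
    have : x ∈ ⋃ p ∈ associatedPrimes R R, (p : Set R) := by
      rw [biUnion_associatedPrimes_eq_zero_divisors]
      exact ⟨z, hne, hz⟩
    obtain ⟨p, hp, hxp⟩ := Set.mem_iUnion₂.1 this
    exact hx p (Or.inr (Or.inl hp)) hxp
  refine ⟨x, hxJ, hx V (Or.inl rfl), hreg, ?_⟩
  have hxI : x ∈ I ^ 1 := by simpa using hIJ hxJ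
  obtain ⟨n₀, hn₀⟩ := exists_mem_pow_of_reesTorsion I k
  refine mem_pow_of_mul_mem_pow hreg (n₀ := n₀) fun n hn z hz hxz => hn₀ n hn z hz ?_
  have hprod : reesMonomial 1 x hxI * reesMonomial n z hz ∈ T := by
    intro m c hc
    simp only [reesMonomial, MulMemClass.coe_mul, monomial_mul_monomial, coeff_monomial]
    split_ifs with h
    · subst h
      rw [show 1 + n + k + 1 = n + 2 + k by ring, pow_add]
      exact Ideal.mul_mem_mul hxz hc
    · simp
  have hzT : reesMonomial n z hz ∈ T := by
    by_contra hne
    have : reesMonomial 1 x hxI ∈ ⋃ p ∈ associatedPrimes (reesAlgebra I) (reesAlgebra I ⧸ T),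
        (p : Set (reesAlgebra I)) := by
      rw [biUnion_associatedPrimes_eq_zero_divisors]
      refine ⟨Ideal.Quotient.mk T (reesMonomial n z hz), ?_, ?_⟩
      · rwa [Ne, Ideal.Quotient.eq_zero_iff_mem]
      · exact Ideal.Quotient.eq_zero_iff_mem.2 hprod
    obtain ⟨Q, hQ, hxQ⟩ := Set.mem_iUnion₂.1 this
    exact hx _ (Or.inr (Or.inr ⟨Q, hQ, rfl⟩)) ⟨hxI, hxQ⟩
  intro c hc
  simpa [reesMonomial] using hzT n c hc

end Superficial
end RossiBound

namespace RossiBound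

/-! ### Minimal reductions are generated by a regular sequence of length two. -/

section TwoGenerators

variable {R : Type*} [CommRing R]

/-- In this form the infinite residue field passes to quotient rings simply by taking images. -/
theorem exists_isUnit_sub [IsLocalRing R] [Infinite (IsLocalRing.ResidueField R)] :
    ∃ u : ℕ → R, ∀ i j, i ≠ j → IsUnit (u i - u j) := by
  let e := Infinite.natEmbedding (IsLocalRing.ResidueField R)
  choose u hu using fun i => IsLocalRing.residue_surjective (R := R) (e i)
  refine ⟨u, fun i j hij => ?_⟩
  by_contra h
  have := (IsLocalRing.residue_eq_zero_iff _).2 ((IsLocalRing.mem_maximalIdeal _).2 h)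
  rw [map_sub, hu, hu, sub_eq_zero] at this
  exact hij (e.injective this)

/-- A local ring of depth two has a regular sequence of length two. -/
theorem exists_regular_pair [IsLocalRing R] (h : depth R = 2) :
    ∃ a ∈ IsLocalRing.maximalIdeal R, ∃ b ∈ IsLocalRing.maximalIdeal R,
      (∀ z, a * z = 0 → z = 0) ∧ ∀ z, b * z ∈ Ideal.span {a} → z ∈ Ideal.span {a} := by
  have hex : ∃ rs : {rs : List R // RingTheory.Sequence.IsRegular R rs ∧
      ∀ r ∈ rs, r ∈ IsLocalRing.maximalIdeal R}, 2 ≤ rs.1.length := by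
    by_contra! hlt
    have : depth R ≤ 1 := iSup_le fun rs => by
      have := hlt rs
      exact_mod_cast Nat.lt_succ_iff.1 this
    rw [h] at this
    exact absurd this (by decide)
  obtain ⟨⟨rs, hreg, hm⟩, hlen⟩ := hex
  match rs, hreg, hm, hlen with
  | a :: b :: l, hreg, hm, _ =>
    have hw := hreg.toIsWeaklyRegular
    rw [RingTheory.Sequence.isWeaklyRegular_iff_Fin] at hw
    refine ⟨a, hm a (by simp), b, hm b (by simp), fun z hz => ?_, fun z hz => ?_⟩
    · have h0 := hw ⟨0, by simp⟩
      have := (isSMulRegular_iff_right_eq_zero_of_smul).1 h0 (Submodule.Quotient.mk z) ?_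
      · simpa using (Submodule.Quotient.mk_eq_zero _).1 this
      · rw [← Submodule.Quotient.mk_smul, Submodule.Quotient.mk_eq_zero]
        simpa using hz
    · have h1 := hw ⟨1, by simp⟩
      have := (isSMulRegular_iff_right_eq_zero_of_smul).1 h1 (Submodule.Quotient.mk z) ?_
      · simpa using (Submodule.Quotient.mk_eq_zero _).1 this
      · rw [← Submodule.Quotient.mk_smul, Submodule.Quotient.mk_eq_zero]
        simpa [Ideal.ofList_singleton] using hz

theorem eq_zero_of_pow_mul_eq_zero {a : R} (ha : ∀ z, a * z = 0 → z = 0) (k : ℕ) :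
    ∀ z, a ^ k * z = 0 → z = 0 := by
  induction k with
  | zero => simp
  | succ k ih => exact fun z hz => ih z (ha _ (by rw [← hz]; ring))

/-- Powers of a regular sequence stay regular: for `j = 1`, induct on `k` by cancelling one factor
`a`; then iterate over `j`. -/
theorem pow_dvd_of_pow_dvd_pow_mul {a b : R} (ha : ∀ z, a * z = 0 → z = 0)
    (hb : ∀ z, b * z ∈ Ideal.span {a} → z ∈ Ideal.span {a}) (k j : ℕ) :
    ∀ z, a ^ k ∣ b ^ j * z → a ^ k ∣ z := by
  simp only [Ideal.mem_span_singleton] at hb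
  have hone : ∀ k, ∀ z, a ^ k ∣ b * z → a ^ k ∣ z := by
    intro k
    induction k with
    | zero => simp
    | succ k ih =>
      rintro z hz
      obtain ⟨w, rfl⟩ := hb z ((dvd_pow_self a k.succ_ne_zero).trans hz)
      obtain ⟨v, hv⟩ := hz
      rw [pow_succ']
      refine mul_dvd_mul_left a (ih w ⟨v, ?_⟩)
      rw [← sub_eq_zero]
      refine ha _ ?_
      rw [mul_sub, sub_eq_zero]
      calc a * (b * w) = b * (a * w) := by ring
        _ = a * (a ^ k * v) := by rw [hv]; ring
  induction j with
  | zero => simp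
  | succ j ih => exact fun z hz => ih z (hone k _ (by rwa [← mul_assoc, ← pow_succ']))

/-- In the presence of a regular sequence of length two inside the radical of `J`, a
nonzerodivisor `x` satisfies `xR : J = xR`. -/
theorem mem_span_of_forall_mul_mem {a b x : R} (ha : ∀ z, a * z = 0 → z = 0)
    (hb : ∀ z, b * z ∈ Ideal.span {a} → z ∈ Ideal.span {a}) (hx : ∀ z, x * z = 0 → z = 0)
    {J : Ideal R} (haJ : a ∈ J.radical) (hbJ : b ∈ J.radical) {z : R}
    (hz : ∀ c ∈ J, c * z ∈ Ideal.span {x}) : z ∈ Ideal.span {x} := by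
  obtain ⟨k, hk⟩ := haJ
  obtain ⟨j, hj⟩ := hbJ
  obtain ⟨v, hv⟩ := Ideal.mem_span_singleton.1 (hz _ hk)
  obtain ⟨w, hw⟩ := Ideal.mem_span_singleton.1 (hz _ hj)
  -- Both sides times `x` equal `a ^ k * b ^ j * z`. Regularity then gives `a ^ k ∣ v`, and
  -- cancelling `a ^ k` in `a ^ k * z = x * v` shows `x ∣ z`.
  have h1 : b ^ j * v = a ^ k * w := by
    rw [← sub_eq_zero]
    refine hx _ ?_
    linear_combination a ^ k * hw - b ^ j * hv
  obtain ⟨t, rfl⟩ := pow_dvd_of_pow_dvd_pow_mul ha hb k j v ⟨w, h1⟩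
  refine Ideal.mem_span_singleton.2 ⟨t, ?_⟩
  rw [← sub_eq_zero]
  refine eq_zero_of_pow_mul_eq_zero ha k _ ?_
  linear_combination hv

theorem ringKrullDim_quotient_le {x : R} {k : ℕ} (hR : ringKrullDim R ≤ (k + 1 : ℕ))
    (hx : ∀ z, x * z = 0 → z = 0) : ringKrullDim (R ⧸ Ideal.span {x}) ≤ k := by
  have hx' : x ∈ nonZeroDivisors R := mem_nonZeroDivisors_iff_left.2 hx
  rw [Nat.cast_succ] at hR
  exact ENat.WithBot.add_le_add_one_right_iff.1
    ((ringKrullDim_quotient_succ_le_of_nonZeroDivisor hx').trans hR)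

theorem isMaximal_of_span_le {y : R} (hy : ringKrullDim (R ⧸ Ideal.span {y}) ≤ 0) {P : Ideal R}
    [P.IsPrime] (hP : y ∈ P) : P.IsMaximal := by
  have : Ring.KrullDimLE 0 (R ⧸ Ideal.span {y}) := by
    rw [Ring.krullDimLE_iff]
    exact_mod_cast hy
  have hker : RingHom.ker (Ideal.Quotient.mk (Ideal.span {y})) ≤ P := by
    rwa [Ideal.mk_ker, Ideal.span_singleton_le_iff_mem]
  have := Ideal.map_isPrime_of_surjective Ideal.Quotient.mk_surjective hker
  have hmax : (P.map (Ideal.Quotient.mk (Ideal.span {y}))).IsMaximal :=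
    Ideal.IsPrime.isMaximal' this
  have := Ideal.comap_isMaximal_of_surjective _
    (Ideal.Quotient.mk_surjective (I := Ideal.span {y}))
    (K := P.map (Ideal.Quotient.mk (Ideal.span {y})))
  rwa [Ideal.comap_map_of_surjective' _ Ideal.Quotient.mk_surjective, sup_eq_left.2 hker] at this

/-- An ideal primary to the maximal ideal of a two-dimensional Cohen-Macaulay local ring has a
reduction generated by two elements. -/
theorem exists_reduction_span_pair [IsLocalRing R] [IsNoetherianRing R] {u : ℕ → R}
    (hu : ∀ i j, i ≠ j → IsUnit (u i - u j)) (hdim : ringKrullDim R = 2) {a b : R}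
    (ha : ∀ z, a * z = 0 → z = 0) (hb : ∀ z, b * z ∈ Ideal.span {a} → z ∈ Ideal.span {a})
    {J : Ideal R} (hJ : J ≤ IsLocalRing.maximalIdeal R) (haJ : a ∈ J.radical)
    (hbJ : b ∈ J.radical) : ∃ x ∈ J, ∃ y ∈ J, ∃ n, J ^ (n + 1) = Ideal.span {x, y} * J ^ n := by
  have hann : ∀ z, (∀ c ∈ J, c * z = 0) → z = 0 := by
    intro z hz
    obtain ⟨k, hk⟩ := haJ
    exact eq_zero_of_pow_mul_eq_zero ha k z (hz _ hk)
  have hJ0 : ¬ J ≤ ⊥ := fun h => one_ne_zero (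
    hann 1 fun c hc => by simp [(Submodule.mem_bot R).1 (h hc)])
  -- Here `J` is regarded as a reduction of itself, with `r = 0`. The same is done modulo `x`, where
  -- depth two ensures that the image of `J` kills no nonzero element.
  obtain ⟨x, hxJ, -, hx, n₀, hn₀⟩ := exists_superficial hu (le_refl J) (r := 0) (by simp) hann hJ0
  set q := Ideal.Quotient.mk (Ideal.span {x}) with hq
  have hqs : Function.Surjective q := Ideal.Quotient.mk_surjective
  have hxm : Ideal.span {x} ≠ ⊤ := fun h => by
    rw [Ideal.span_singleton_eq_top] at h
    exact hJ hxJ h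
  have : Nontrivial (R ⧸ Ideal.span {x}) := Ideal.Quotient.nontrivial_iff.2 hxm
  have hann' : ∀ z, (∀ c ∈ J.map q, c * z = 0) → z = 0 := by
    intro z hz
    obtain ⟨z, rfl⟩ := hqs z
    refine Ideal.Quotient.eq_zero_iff_mem.2 (mem_span_of_forall_mul_mem ha hb hx haJ hbJ ?_)
    intro c hc
    have := hz _ (Ideal.mem_map_of_mem q hc)
    rwa [← map_mul, Ideal.Quotient.eq_zero_iff_mem] at this
  have hJ0' : ¬ J.map q ≤ ⊥ :=
    fun h => one_ne_zero (hann' 1 fun c hc => by simp [(Submodule.mem_bot _).1 (h hc)])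
  obtain ⟨y', hyJ', -, hy, n₁, hn₁⟩ := exists_superficial (u := fun i => q (u i))
    (fun i j hij => by rw [← map_sub]; exact (hu i j hij).map q) (le_refl (J.map q)) (r := 0)
    (by simp) hann' hJ0'
  obtain ⟨y, hyJ, rfl⟩ := (Ideal.mem_map_iff_of_surjective q hqs).1 hyJ'
  -- Two nonzerodivisors have brought the dimension down to zero, so every prime containing `q y`
  -- pulls back to the maximal ideal.
  have hrad : J.map q ≤ (Ideal.span {q y}).radical := by
    have hd := ringKrullDim_quotient_le (ringKrullDim_quotient_le
      (R := R) (x := x) (k := 1) (by rw [hdim]; rfl) hx) hy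
    rw [Ideal.radical_eq_sInf]
    refine le_sInf fun P ⟨hyP, hP⟩ => ?_
    have hmax := isMaximal_of_span_le (by exact_mod_cast hd) (hyP (Ideal.mem_span_singleton_self _))
    have := Ideal.comap_isMaximal_of_surjective q hqs (K := P)
    rw [Ideal.map_le_iff_le_comap, IsLocalRing.eq_maximalIdeal this]
    exact hJ
  obtain ⟨N, hN⟩ := Ideal.exists_pow_le_of_le_radical_of_fg hrad (IsNoetherian.noetherian _)
  refine ⟨x, hxJ, y, hyJ, n₀ + n₁ + N, le_antisymm (fun w hw => ?_) ?_⟩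
  · set n := n₀ + n₁ + N with hn
    have hw' : q w ∈ (J.map q) ^ (n + 1) := by
      rw [← Ideal.map_pow]
      exact Ideal.mem_map_of_mem q hw
    -- Modulo `x`, `w` is a multiple of `y`, and superficiality of `y` puts the cofactor in the
    -- image of `J ^ n`. After lifting, `w - y z = x t`, and superficiality of `x` puts `t` in `J ^
    -- n`.
    obtain ⟨z', hz'⟩ := Ideal.mem_span_singleton.1 (hN (Ideal.pow_le_pow_right (by omega) hw'))
    have hz'J := hn₁ n (by omega) z' (hz' ▸ hw')
    rw [← Ideal.map_pow] at hz'J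
    obtain ⟨z, hz, rfl⟩ := (Ideal.mem_map_iff_of_surjective q hqs).1 hz'J
    rw [← map_mul, ← sub_eq_zero, ← map_sub, Ideal.Quotient.eq_zero_iff_mem] at hz'
    obtain ⟨t, ht⟩ := Ideal.mem_span_singleton.1 hz'
    have htJ : t ∈ J ^ n := by
      refine hn₀ n (by omega) t ?_
      rw [← ht, pow_succ']
      rw [pow_succ'] at hw
      exact sub_mem hw (Ideal.mul_mem_mul hyJ hz)
    rw [show w = x * t + y * z by linear_combination ht]
    exact add_mem (Ideal.mul_mem_mul (Ideal.subset_span (by simp)) htJ)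
      (Ideal.mul_mem_mul (Ideal.subset_span (by simp)) hz)
  · rw [pow_succ']
    refine Ideal.mul_mono_left (Ideal.span_le.2 ?_)
    simp [Set.insert_subset_iff, hxJ, hyJ]

theorem IsReduction.trans {L J I : Ideal R} (hL : IsReduction L J) (hJ : IsReduction J I) :
    IsReduction L I := by
  obtain ⟨hLJ, n, hn⟩ := hL
  obtain ⟨hJI, m, hm⟩ := hJ
  refine ⟨hLJ.trans hJI, m + n, ?_⟩
  have h : ∀ k, I ^ (m + k) = J ^ k * I ^ m := by
    intro k
    induction k with
    | zero => simp
    | succ k ih =>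
      calc I ^ (m + (k + 1)) = I * I ^ (m + k) := by ring
        _ = J ^ k * I ^ (m + 1) := by rw [ih]; ring
        _ = J ^ (k + 1) * I ^ m := by rw [hm]; ring
  rw [add_assoc, h, hn, mul_assoc, ← h]

/-- A minimal reduction of a primary ideal of a two-dimensional Cohen-Macaulay local ring is
generated by a regular sequence whose first element is superficial. -/
theorem IsMinimalReduction.exists_generators [IsLocalRing R] [IsCohenMacaulayLocalRing R]
    [Infinite (IsLocalRing.ResidueField R)] (hdim : ringKrullDim R = 2) {I J : Ideal R}
    (hI : IsMPrimary I) (hJ : IsMinimalReduction J I) :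
    ∃ x y, J = Ideal.span {x, y} ∧ (∀ z, x * z = 0 → z = 0) ∧
      (∀ z, y * z ∈ Ideal.span {x} → z ∈ Ideal.span {x}) ∧
      ∃ n₀, ∀ n ≥ n₀, ∀ z, x * z ∈ I ^ (n + 1) → z ∈ I ^ n := by
  obtain ⟨u, hu⟩ := exists_isUnit_sub (R := R)
  have hdepth : depth R = 2 := by
    have := IsCohenMacaulayLocalRing.depth_eq_dim (R := R)
    rw [hdim] at this
    exact WithBot.coe_injective this
  obtain ⟨a, ham, b, hbm, ha, hb⟩ := exists_regular_pair hdepth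
  have hJI : J ≤ I := hJ.1.1
  obtain ⟨r, hr⟩ := hJ.1.2
  have hIm : I ≤ IsLocalRing.maximalIdeal R := hI.2 ▸ Ideal.le_radical
  have hrad : J.radical = IsLocalRing.maximalIdeal R := by
    refine le_antisymm (hI.2 ▸ Ideal.radical_mono hJI) ?_
    rw [← hI.2, ← Ideal.radical_pow I r.succ_ne_zero]
    exact Ideal.radical_mono (hr ▸ Ideal.mul_le_left)
  have haJ : a ∈ J.radical := hrad ▸ ham
  have hbJ : b ∈ J.radical := hrad ▸ hbm
  obtain ⟨x₁, hx₁, y₁, hy₁, n, hn⟩ :=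
    exists_reduction_span_pair hu hdim ha hb (hJI.trans hIm) haJ hbJ
  have hle : Ideal.span {x₁, y₁} ≤ J := Ideal.span_le.2 (by simp [Set.insert_subset_iff, hx₁, hy₁])
  have hJeq : J = Ideal.span {x₁, y₁} :=
    le_antisymm (hJ.2 (IsReduction.trans ⟨hle, n, hn⟩ hJ.1) hle) hle
  have hannJ : ∀ z, (∀ c ∈ J, c * z = 0) → z = 0 := by
    intro z hz
    obtain ⟨k, hk⟩ := haJ
    exact eq_zero_of_pow_mul_eq_zero ha k z (hz _ hk)
  -- By Nakayama. Choosing `x` outside `𝔪 J` forces one coefficient of `x` in terms of `x₁, y₁` to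
  -- be a unit, so `x` can replace a generator.
  have hV : ¬ J ≤ IsLocalRing.maximalIdeal R * J := by
    intro h
    have h0 := Submodule.eq_bot_of_le_smul_of_le_jacobson_bot (IsLocalRing.maximalIdeal R) J
      (IsNoetherian.noetherian J) h (IsLocalRing.jacobson_eq_maximalIdeal ⊥ bot_ne_top).ge
    exact one_ne_zero (hannJ 1 fun c hc => by rw [h0, Submodule.mem_bot] at hc; simp [hc])
  obtain ⟨x, hxJ, hxV, hx, hsup⟩ := exists_superficial hu hJI hr
    (fun z hz => hannJ z fun c hc => hz c (hJI hc)) hV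
  obtain ⟨y, hy⟩ : ∃ y, J = Ideal.span {x, y} := by
    obtain ⟨α, β, hαβ⟩ := Ideal.mem_span_pair.1 (hJeq ▸ hxJ)
    by_cases hα : IsUnit α
    · refine ⟨y₁, ?_⟩
      obtain ⟨α, rfl⟩ := hα
      rw [hJeq]
      refine le_antisymm (Ideal.span_le.2 ?_) (Ideal.span_le.2 ?_)
      · rintro z (rfl | rfl)
        · exact Ideal.mem_span_pair.2 ⟨↑α⁻¹, -(↑α⁻¹ * β), by
            rw [← hαβ]; linear_combination z * α.inv_mul⟩
        · exact Ideal.subset_span (by simp)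
      · rintro z (rfl | rfl)
        · exact hJeq ▸ hxJ
        · exact Ideal.subset_span (by simp)
    · by_cases hβ : IsUnit β
      · refine ⟨x₁, ?_⟩
        obtain ⟨β, rfl⟩ := hβ
        rw [hJeq]
        refine le_antisymm (Ideal.span_le.2 ?_) (Ideal.span_le.2 ?_)
        · rintro z (rfl | rfl)
          · exact Ideal.subset_span (by simp)
          · exact Ideal.mem_span_pair.2 ⟨↑β⁻¹, -(↑β⁻¹ * α), by
              rw [← hαβ]; linear_combination z * β.inv_mul⟩
        · rintro z (rfl | rfl)
          · exact hJeq ▸ hxJ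
          · exact Ideal.subset_span (by simp)
      · refine absurd ?_ hxV
        rw [← hαβ]
        exact add_mem (Ideal.mul_mem_mul hα hx₁) (Ideal.mul_mem_mul hβ hy₁)
  refine ⟨x, y, hy, hx, fun z hz => ?_, hsup⟩
  refine mem_span_of_forall_mul_mem ha hb hx haJ hbJ fun c hc => ?_
  rw [hy] at hc
  obtain ⟨α, β, rfl⟩ := Ideal.mem_span_pair.1 hc
  rw [show (α * x + β * y) * z = x * (α * z) + β * (y * z) by ring]
  exact add_mem (Ideal.mul_mem_right _ _ (Ideal.mem_span_singleton_self x))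
    (Ideal.mul_mem_left _ _ hz)

end TwoGenerators
end RossiBound

namespace RossiBound

/-! ### A graded determinant trick. -/

section Determinant

open scoped Pointwise

variable {R : Type*} [CommRing R] {ι : Type*}

theorem prod_mem_pow_sum {κ : Type*} {I : Ideal R} {f : κ → R} {e : κ → ℕ} (s : Finset κ)
    (h : ∀ i ∈ s, f i ∈ I ^ e i) : ∏ i ∈ s, f i ∈ I ^ ∑ i ∈ s, e i := by
  rw [← Finset.prod_pow_eq_pow_sum]
  exact Ideal.prod_mem_prod h

/-- After expansion, every term other than `∏ a i` has a factor `c i` in `J`. For empty `s` the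
difference is zero, so the truncated exponent is harmless. -/
theorem prod_sub_sub_prod_mem [DecidableEq ι] {I J : Ideal R} (hJI : J ≤ I) {a c : ι → R}
    (ha : ∀ i, a i ∈ I)
    (hc : ∀ i, c i ∈ J) (s : Finset ι) :
    ∏ i ∈ s, (a i - c i) - ∏ i ∈ s, a i ∈ J * I ^ (s.card - 1) := by
  induction s using Finset.induction_on with
  | empty => simp
  | insert j s hj ih =>
    rw [Finset.prod_insert hj, Finset.prod_insert hj, Finset.card_insert_of_notMem hj,
      Nat.add_sub_cancel]
    have h1 : ∏ i ∈ s, (a i - c i) ∈ I ^ s.card := by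
      have := prod_mem_pow_sum s (e := fun _ => 1) (I := I) (f := fun i => a i - c i)
        fun i _ => by simpa using sub_mem (ha i) (hJI (hc i))
      simpa using this
    have h2 : a j * (∏ i ∈ s, (a i - c i) - ∏ i ∈ s, a i) ∈ J * I ^ s.card := by
      rcases s.eq_empty_or_nonempty with rfl | hs
      · simp
      · obtain ⟨k, hk⟩ := Nat.exists_eq_succ_of_ne_zero hs.card_pos.ne'
        rw [hk] at ih ⊢
        have := Ideal.mul_mem_mul (ha j) ih
        rwa [Nat.succ_sub_one, mul_left_comm, ← pow_succ'] at this
    rw [show (a j - c j) * ∏ i ∈ s, (a i - c i) - a j * ∏ i ∈ s, a i =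
      a j * (∏ i ∈ s, (a i - c i) - ∏ i ∈ s, a i) - c j * ∏ i ∈ s, (a i - c i) by ring]
    exact sub_mem h2 (Ideal.mul_mem_mul (hc j) h1)

variable [Fintype ι]

/-- The determinant of a homogeneous matrix with row degrees `r` and column degrees `c`. -/
theorem det_mem_pow [DecidableEq ι] {I : Ideal R} {M : Matrix ι ι R} {r c : ι → ℕ}
    (h : ∀ i j, M i j ∈ I ^ (r i - c j)) (h0 : ∀ i j, r i < c j → M i j = 0) :
    M.det ∈ I ^ (∑ i, r i - ∑ i, c i) := by
  rw [Matrix.det_apply]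
  refine Ideal.sum_mem _ fun σ _ => Submodule.smul_of_tower_mem _ _ ?_
  -- For such permutations no subtraction is truncated and the degrees telescope; every other
  -- permutation meets a zero entry.
  by_cases hσ : ∀ i, c i ≤ r (σ i)
  · have := prod_mem_pow_sum Finset.univ fun i _ => h (σ i) i
    rwa [Finset.sum_tsub_distrib _ fun i _ => hσ i, Equiv.sum_comp σ r] at this
  · push Not at hσ
    obtain ⟨i, hi⟩ := hσ
    have : ∏ j, M (σ j) j = 0 := Finset.prod_eq_zero (Finset.mem_univ i) (h0 _ _ hi)
    exact this ▸ zero_mem _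

/-- The determinant trick for a homogeneous matrix `C` of degree one with coefficients in `J`. -/
theorem det_diagonal_sub_sub_prod_mem [DecidableEq ι] {I J : Ideal R} (hJI : J ≤ I)
    {a : ι → R} {d : ι → ℕ} {C : Matrix ι ι R} (ha : ∀ i, a i ∈ I) (hC : ∀ i j, C i j ∈ J ^ (d i + 1 - d j))
    (h0 : ∀ i j, d i + 1 < d j → C i j = 0) :
    (Matrix.diagonal a - C).det - ∏ i, a i ∈ J * I ^ (Fintype.card ι - 1) := by
  have hM : ∀ i j, (Matrix.diagonal a - C) i j ∈ I ^ (d i + 1 - d j) := by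
    intro i j
    refine sub_mem ?_ (Ideal.pow_right_mono hJI _ (hC i j))
    rw [Matrix.diagonal_apply]
    split_ifs with hij
    · subst hij
      simpa using ha i
    · exact zero_mem _
  rw [Matrix.det_apply, ← Finset.add_sum_erase _ _ (Finset.mem_univ (1 : Equiv.Perm ι)),
    add_sub_right_comm]
  refine add_mem ?_ (Ideal.sum_mem _ fun σ hσ => Submodule.smul_of_tower_mem _ _ ?_)
  · have := prod_sub_sub_prod_mem hJI ha (c := fun i => C i i)
      (fun i => by simpa using hC i i) Finset.univ
    simpa using this
  · by_cases hd : ∀ i, d i ≤ d (σ i) + 1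
    · have hne : σ.support.Nonempty := by
        rw [Finset.nonempty_iff_ne_empty, Ne, Equiv.Perm.support_eq_empty_iff]
        exact Finset.ne_of_mem_erase hσ
      -- At a moved index of least degree, `d i ≤ d (σ i)`. The off-diagonal entry there lies in a
      -- positive power of `J`, which supplies the factor from `J`.
      obtain ⟨i, hi, hmin⟩ := Finset.exists_min_image _ d hne
      have hle : d i ≤ d (σ i) := hmin _ (Equiv.Perm.apply_mem_support.2 hi)
      have hei : (Matrix.diagonal a - C) (σ i) i ∈ J * I ^ (d (σ i) - d i) := by
        rw [Matrix.sub_apply, Matrix.diagonal_apply_ne _ (Equiv.Perm.mem_support.1 hi), zero_sub]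
        refine neg_mem (Ideal.mul_mono_right (Ideal.pow_right_mono hJI _) ?_)
        rw [← pow_succ', ← Nat.sub_add_comm hle]
        exact hC _ _
      rw [← Finset.mul_prod_erase _ _ (Finset.mem_univ i)]
      have hrest := prod_mem_pow_sum (Finset.univ.erase i) fun j _ => hM (σ j) j
      have hsum : ∑ j, (d (σ j) + 1 - d j) = Fintype.card ι := by
        rw [Finset.sum_tsub_distrib _ fun j _ => hd j, Equiv.sum_comp σ fun j => d j + 1,
          Finset.sum_add_distrib]
        simp
      rw [← Finset.add_sum_erase _ _ (Finset.mem_univ i)] at hsum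
      have := Ideal.mul_mem_mul hei hrest
      rwa [mul_assoc, ← pow_add, show d (σ i) - d i +
        ∑ j ∈ Finset.univ.erase i, (d (σ j) + 1 - d j) = Fintype.card ι - 1 by omega] at this
    · push Not at hd
      obtain ⟨i, hi⟩ := hd
      rw [Finset.prod_eq_zero (Finset.mem_univ i)]
      · exact zero_mem _
      · rw [Matrix.sub_apply, h0 _ _ hi, Matrix.diagonal_apply_ne, sub_zero]
        rintro h
        rw [h] at hi
        omega

/-- The degree `n` part of the `R[It]`-module generated by `1` and, over `R[Jt]`, by the elements
`m i` of degree `d i`. -/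
def gradedSpan (I J : Ideal R) (d : ι → ℕ) (m : ι → R) (n : ℕ) : Ideal R where
  carrier := {z | ∃ c : ι → R, (∀ i, c i ∈ J ^ (n - d i)) ∧ (∀ i, n < d i → c i = 0) ∧
    z - ∑ i, c i * m i ∈ I ^ n}
  zero_mem' := ⟨0, by simp⟩
  add_mem' := by
    rintro z w ⟨c, hc, hc0, hz⟩ ⟨e, he, he0, hw⟩
    refine ⟨c + e, fun i => add_mem (hc i) (he i), fun i hi => by simp [hc0 i hi, he0 i hi], ?_⟩
    convert add_mem hz hw using 1
    simp only [Pi.add_apply, add_mul, Finset.sum_add_distrib]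
    ring
  smul_mem' := by
    rintro r z ⟨c, hc, hc0, hz⟩
    refine ⟨r • c, fun i => Ideal.mul_mem_left _ _ (hc i), fun i hi => by simp [hc0 i hi], ?_⟩
    convert Ideal.mul_mem_left _ r hz using 1
    simp [mul_sub, Finset.mul_sum, mul_assoc]

/-- Graded Nakayama by induction on the degree. Degree zero needs no generator, since `I ^ 0` is the
whole ring. -/
theorem le_gradedSpan [DecidableEq ι] {I J : Ideal R} (hJI : J ≤ I) {d : ι → ℕ} {m : ι → R}
    {F : ℕ → Ideal R}
    (hF : ∀ n, F (n + 1) ≤ I ^ (n + 1) ⊔ J * F n ⊔ Ideal.span {z | ∃ i, d i = n + 1 ∧ m i = z})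
    (n : ℕ) : F n ≤ gradedSpan I J d m n := by
  induction n with
  | zero => exact fun z _ => ⟨0, by simp⟩
  | succ n ih =>
    refine (hF n).trans (sup_le (sup_le (fun z hz => ⟨0, by simpa using hz⟩) ?_)
      (Ideal.span_le.2 ?_))
    · refine Ideal.mul_le.2 fun r hr z hz => ?_
      obtain ⟨c, hc, hc0, hz⟩ := ih hz
      refine ⟨fun i => r * c i, fun i => ?_, fun i hi => by simp [hc0 i (by omega)], ?_⟩
      · rcases lt_or_ge n (d i) with hi | hi
        · simp [hc0 i hi]
        · rw [Nat.sub_add_comm hi, pow_succ']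
          exact Ideal.mul_mem_mul hr (hc i)
      · rw [pow_succ']
        convert Ideal.mul_mem_mul (hJI hr) hz using 1
        simp [mul_sub, Finset.mul_sum, mul_assoc]
    · rintro _ ⟨i, hi, rfl⟩
      refine ⟨Pi.single i 1, fun j => ?_, fun j hj => ?_, ?_⟩
      · by_cases hij : j = i
        · subst hij
          simp [hi]
        · simp [hij]
      · rw [Pi.single_eq_of_ne]
        rintro rfl
        omega
      · simp [Pi.single_apply, ite_mul]

theorem mul_mem_of_forall_prod_mul_mem {I L : Ideal R} {x : R}
    (h : ∀ a : ι → R, (∀ i, a i ∈ I) → (∏ i, a i) * x ∈ L) {y : R}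
    (hy : y ∈ I ^ Fintype.card ι) : y * x ∈ L := by
  have hspan : I ^ Fintype.card ι = Ideal.span (∏ _i : ι, (I : Set R)) := by
    rw [← Ideal.prod_span]
    simp
  rw [hspan] at hy
  induction hy using Submodule.span_induction with
  | mem z hz =>
    obtain ⟨a, ha, rfl⟩ := (Set.mem_fintype_prod _ _).1 hz
    exact h a fun i => ha i
  | zero => simp
  | add z w _ _ hz hw => rw [add_mul]; exact add_mem hz hw
  | smul r z _ hz => rw [smul_eq_mul, mul_assoc]; exact L.mul_mem_left _ hz

/-- If `I ^ (s + 1) ⊆ J F s` for a filtration `F` whose module over the Rees algebra of `J`,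
modulo the Rees algebra of `I`, has `g` generators, then `I ^ (s + g + 1) = J I ^ (s + g)`. -/
theorem pow_succ_eq_mul_pow_of_generators [DecidableEq ι] {I J : Ideal R} (hJI : J ≤ I)
    {d : ι → ℕ} {m : ι → R} {F : ℕ → Ideal R} (hIF : ∀ n, I * F n ≤ F (n + 1)) (hm : ∀ i, m i ∈ F (d i))
    (hF : ∀ n, F (n + 1) ≤ I ^ (n + 1) ⊔ J * F n ⊔ Ideal.span {z | ∃ i, d i = n + 1 ∧ m i = z})
    {s : ℕ} (hs : I ^ (s + 1) ≤ J * F s) :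
    I ^ (s + Fintype.card ι + 1) = J * I ^ (s + Fintype.card ι) := by
  set g := Fintype.card ι with hg
  have hspan := le_gradedSpan hJI hF
  refine le_antisymm ?_ (by rw [pow_succ']; exact Ideal.mul_mono_left hJI)
  rw [show s + g + 1 = g + (s + 1) by ring, pow_add]
  refine Ideal.mul_le.2 fun y hy x hx => mul_mem_of_forall_prod_mul_mem (fun a ha => ?_) hy
  -- Multiplying a generator by `a i ∈ I` raises its degree by one; rewriting the product in terms
  -- of the generators gives a row of a homogeneous matrix.
  have hrow : ∀ i, ∃ c : ι → R, (∀ j, c j ∈ J ^ (d i + 1 - d j)) ∧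
      (∀ j, d i + 1 < d j → c j = 0) ∧ a i * m i - ∑ j, c j * m j ∈ I ^ (d i + 1) :=
    fun i => hspan _ (hIF _ (Ideal.mul_mem_mul (ha i) (hm i)))
  choose C hC hC0 hb using hrow
  set M : Matrix ι ι R := Matrix.diagonal a - Matrix.of C with hM
  have hMI : ∀ i j, M i j ∈ I ^ (d i + 1 - d j) := by
    intro i j
    refine sub_mem ?_ (Ideal.pow_right_mono hJI _ (hC i j))
    rw [Matrix.diagonal_apply]
    split_ifs with hij
    · subst hij
      simpa using ha i
    · exact zero_mem _
  have hM0 : ∀ i j, d i + 1 < d j → M i j = 0 := by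
    intro i j hij
    rw [hM, Matrix.sub_apply, Matrix.diagonal_apply_ne, Matrix.of_apply, hC0 i j hij, sub_zero]
    rintro rfl
    omega
  have hMm : M.mulVec m = fun i => a i * m i - ∑ j, C i j * m j := by
    rw [hM, Matrix.sub_mulVec]
    funext i
    rw [Pi.sub_apply, Matrix.mulVec_diagonal]
    simp [Matrix.mulVec, dotProduct]
  have hdet : M.det ∈ I ^ g := by
    have := det_mem_pow hMI hM0
    rwa [Finset.sum_add_distrib, Nat.add_sub_cancel_left, Finset.sum_const, smul_eq_mul, mul_one,
      Finset.card_univ] at this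
  -- Cramer's rule: the column `k` replaced by `M m` has entries in `I ^ (d i + 1)`, so its column
  -- degree becomes `0` instead of `d k`, a gain of `d k`.
  have hdetm : ∀ k, M.det * m k ∈ I ^ (g + d k) := by
    intro k
    have h1 : M.det • m = M.cramer (M.mulVec m) := by
      rw [Matrix.cramer_eq_adjugate_mulVec, Matrix.mulVec_mulVec, Matrix.adjugate_mul,
        Matrix.smul_mulVec, Matrix.one_mulVec]
    have h2 := congrFun h1 k
    rw [Pi.smul_apply, smul_eq_mul, Matrix.cramer_apply] at h2
    rw [h2]
    have h3 := det_mem_pow (I := I) (M := M.updateCol k (M.mulVec m)) (r := fun i => d i + 1)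
      (c := Function.update d k 0) (fun i j => ?_) (fun i j => ?_)
    · convert h3 using 2
      rw [Finset.sum_update_of_mem (Finset.mem_univ k), Finset.sum_add_distrib, zero_add,
        ← Finset.add_sum_erase _ d (Finset.mem_univ k), Finset.sdiff_singleton_eq_erase]
      simp
      omega
    · by_cases hj : j = k
      · subst hj
        simpa [hMm] using hb i
      · simpa [hj] using hMI i j
    · by_cases hj : j = k
      · subst hj
        simp
      · simpa [hj] using hM0 i j
  have hdetF : ∀ z ∈ F s, M.det * z ∈ I ^ (s + g) := by
    intro z hz
    obtain ⟨c, hc, hc0, hz⟩ := hspan s hz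
    rw [show M.det * z = M.det * (z - ∑ i, c i * m i) + ∑ i, c i * (M.det * m i) by
      rw [mul_sub, Finset.mul_sum, sub_add_eq_add_sub, add_sub_assoc, left_eq_add, sub_eq_zero]
      exact Finset.sum_congr rfl fun i _ => by ring]
    refine add_mem ?_ (Ideal.sum_mem _ fun i _ => ?_)
    · rw [add_comm, pow_add]
      exact Ideal.mul_mem_mul hdet hz
    · rcases lt_or_ge s (d i) with hi | hi
      · simp [hc0 i hi]
      · rw [show s + g = (s - d i) + (g + d i) by omega, pow_add]
        exact Ideal.mul_mem_mul (Ideal.pow_right_mono hJI _ (hc i)) (hdetm i)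
  have h1 : M.det * x ∈ J * I ^ (s + g) := by
    refine Submodule.mul_induction_on (hs hx) (fun b hb z hz => ?_) fun z w hz hw => ?_
    · rw [mul_left_comm]
      exact Ideal.mul_mem_mul hb (hdetF z hz)
    · rw [mul_add]
      exact add_mem hz hw
  -- The determinant agrees with `∏ a i` modulo `J I ^ (g - 1)`, and `x ∈ I ^ (s + 1)` brings the
  -- total to `J I ^ (s + g)`. The case `g = 0` is separate because `g - 1` truncates.
  have h2 : (M.det - ∏ i, a i) * x ∈ J * I ^ (s + g) := by
    rcases Nat.eq_zero_or_pos g with h0 | h0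
    · have : IsEmpty ι := Fintype.card_eq_zero_iff.1 h0
      simp
    · have := Ideal.mul_mem_mul (det_diagonal_sub_sub_prod_mem hJI ha hC hC0) hx
      rwa [mul_assoc, ← pow_add, show Fintype.card ι - 1 + (s + 1) = s + g by omega] at this
  rw [show (∏ i, a i) * x = M.det * x - (M.det - ∏ i, a i) * x by ring]
  exact sub_mem h1 h2

end Determinant
end RossiBound

namespace RossiBound

/-! ### Lengths of quotients and numbers of generators. -/

section Length

variable {R : Type*} [CommRing R]

/-- From the exact sequence `0 → R/(A : w) → R/A → R/(A + (w)) → 0`, whose first map is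
multiplication by `w`. -/
theorem length_quotient_eq_add (A : Ideal R) (w : R) :
    Module.length R (R ⧸ A) =
      Module.length R (R ⧸ A.colon {w}) + Module.length R (R ⧸ (A ⊔ Ideal.span {w})) := by
  have hker : LinearMap.ker (LinearMap.toSpanSingleton R (R ⧸ A) (Submodule.Quotient.mk w)) =
      A.colon {w} := by
    ext z
    rw [LinearMap.mem_ker, LinearMap.toSpanSingleton_apply, ← Submodule.Quotient.mk_smul,
      Submodule.Quotient.mk_eq_zero, Submodule.mem_colon_singleton]
  refine Module.length_eq_add_of_exact
    ((A.colon {w}).liftQ (LinearMap.toSpanSingleton R (R ⧸ A) (Submodule.Quotient.mk w)) hker.ge)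
    (Submodule.factor (le_sup_left : A ≤ A ⊔ Ideal.span {w})) ?_ (Submodule.factor_surjective _) ?_
  · exact LinearMap.ker_eq_bot.1 (Submodule.ker_liftQ_eq_bot _ _ _ hker.le)
  · rw [LinearMap.exact_iff, Submodule.range_liftQ]
    ext z
    obtain ⟨z, rfl⟩ := Submodule.Quotient.mk_surjective _ z
    change (Submodule.Quotient.mk z : R ⧸ (A ⊔ Ideal.span {w})) = 0 ↔ _
    rw [Submodule.Quotient.mk_eq_zero, sup_comm,
      Ideal.mem_span_singleton_sup, LinearMap.mem_range]
    constructor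
    · rintro ⟨c, b, hb, rfl⟩
      refine ⟨c, ?_⟩
      rw [LinearMap.toSpanSingleton_apply, ← Submodule.Quotient.mk_smul, Submodule.Quotient.eq]
      simpa using neg_mem hb
    · rintro ⟨c, hc⟩
      rw [LinearMap.toSpanSingleton_apply, ← Submodule.Quotient.mk_smul,
        Submodule.Quotient.eq] at hc
      exact ⟨c, z - c * w, by simpa using neg_mem hc, by ring⟩

/-- The length of `R ⧸ J F` for an ideal `J` generated by a regular sequence `x, y`. -/
theorem length_quotient_span_pair_mul {x y : R} (hx : ∀ z, x * z = 0 → z = 0)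
    (hy : ∀ z, y * z ∈ Ideal.span {x} → z ∈ Ideal.span {x}) {F : Ideal R}
    (hF : ∀ z, x * z ∈ F → y * z ∈ F) :
    Module.length R (R ⧸ Ideal.span {x, y} * F) + Module.length R (R ⧸ F.colon {x}) =
      Module.length R (R ⧸ Ideal.span {x, y}) + 2 * Module.length R (R ⧸ F) := by
  have hmem : ∀ z, z ∈ Ideal.span {x, y} * F ↔ ∃ f ∈ F, ∃ g ∈ F, z = x * f + y * g := by
    intro z
    rw [Ideal.span_insert, Ideal.sup_mul, Submodule.mem_sup]
    simp only [Ideal.mem_span_singleton_mul]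
    constructor
    · rintro ⟨_, ⟨f, hf, rfl⟩, _, ⟨g, hg, rfl⟩, rfl⟩
      exact ⟨f, hf, g, hg, rfl⟩
    · rintro ⟨f, hf, g, hg, rfl⟩
      exact ⟨_, ⟨f, hf, rfl⟩, _, ⟨g, hg, rfl⟩, rfl⟩
  -- The colons are `JF : x = F` (here `hF` is needed), `F : x`, and `(JF + (x)) : y = F + (x)`. The
  -- term `λ(R / (F + (x)))` is then eliminated between the three formulas.
  have h1 := length_quotient_eq_add (Ideal.span {x, y} * F) x
  have h2 := length_quotient_eq_add F x
  have h3 := length_quotient_eq_add (Ideal.span {x, y} * F ⊔ Ideal.span {x}) y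
  have hc1 : (Ideal.span {x, y} * F).colon {x} = F := by
    ext z
    rw [Submodule.mem_colon_singleton, smul_eq_mul, hmem]
    constructor
    · rintro ⟨f, hf, g, hg, h⟩
      obtain ⟨t, rfl⟩ := Ideal.mem_span_singleton.1 (hy g (Ideal.mem_span_singleton.2
        ⟨z - f, by linear_combination -h⟩))
      have : z - f - y * t = 0 := hx _ (by linear_combination h)
      rw [show z = f + y * t by linear_combination this]
      exact add_mem hf (hF t hg)
    · exact fun hz => ⟨z, hz, 0, zero_mem _, by ring⟩
  have hc3 : (Ideal.span {x, y} * F ⊔ Ideal.span {x}).colon {y} = F ⊔ Ideal.span {x} := by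
    ext z
    rw [Submodule.mem_colon_singleton, smul_eq_mul, sup_comm, sup_comm F,
      Ideal.mem_span_singleton_sup, Ideal.mem_span_singleton_sup]
    constructor
    · rintro ⟨c, b, hb, h⟩
      obtain ⟨f, hf, g, hg, rfl⟩ := (hmem b).1 hb
      obtain ⟨t, ht⟩ := Ideal.mem_span_singleton.1 (hy (z - g) (Ideal.mem_span_singleton.2
        ⟨c + f, by linear_combination -h⟩))
      exact ⟨t, g, hg, by linear_combination -ht⟩
    · rintro ⟨c, b, hb, rfl⟩
      exact ⟨c * y, y * b, (hmem _).2 ⟨0, zero_mem _, b, hb, by ring⟩, by ring⟩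
  have hs3 : Ideal.span {x, y} * F ⊔ Ideal.span {x} ⊔ Ideal.span {y} = Ideal.span {x, y} := by
    rw [sup_assoc, ← Ideal.span_insert, sup_eq_right]
    exact Ideal.mul_le_left
  rw [hc1] at h1
  rw [hc3, hs3] at h3
  rw [h1, h3, two_mul]
  nth_rw 3 [h2]
  ring

/-- Adjoining `w ∈ B \ A` to `A` lowers the colength by `λ(R / (A : w)) ≥ 1`, so at most `λ(B / A)`
generators are needed. -/
theorem exists_finset_generators {A B : Ideal R} (hA : Module.length R (R ⧸ A) ≠ ⊤) (hAB : A ≤ B) :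
    ∃ S : Finset R, (∀ z ∈ S, z ∈ B) ∧ B ≤ A ⊔ Ideal.span S ∧ S.card + colength B ≤ colength A := by
  classical
  induction h : colength A using Nat.strong_induction_on generalizing A with
  | _ n ih =>
    by_cases hBA : B ≤ A
    · exact ⟨∅, by simp, by simpa using hBA, by simp [← h, le_antisymm hAB hBA]⟩
    obtain ⟨w, hwB, hwA⟩ := Set.not_subset.1 hBA
    have hL := length_quotient_eq_add A w
    rw [hL] at hA
    obtain ⟨hA1, hA2⟩ := WithTop.add_ne_top.1 hA
    have hne : A.colon {w} ≠ ⊤ := fun h => hwA <| by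
      have : (1 : R) ∈ A.colon {w} := h ▸ Submodule.mem_top
      simpa [Submodule.mem_colon_singleton] using this
    have : Nontrivial (R ⧸ A.colon {w}) := Ideal.Quotient.nontrivial_iff.2 hne
    have hpos : 0 < (Module.length R (R ⧸ A.colon {w})).toNat := by
      rw [Nat.pos_iff_ne_zero, Ne, ENat.toNat_eq_zero, not_or]
      exact ⟨Module.length_pos.ne', hA1⟩
    have hcol : colength A = (Module.length R (R ⧸ A.colon {w})).toNat +
        colength (A ⊔ Ideal.span {w}) := by
      rw [colength, hL, ENat.toNat_add hA1 hA2, colength]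
    obtain ⟨S, hSB, hBS, hS⟩ := ih _ (by omega) hA2
      (sup_le hAB ((Ideal.span_singleton_le_iff_mem _).2 hwB)) rfl
    refine ⟨insert w S, ?_, ?_, ?_⟩
    · intro z hz
      rcases Finset.mem_insert.1 hz with rfl | hz
      exacts [hwB, hSB z hz]
    · rwa [Finset.coe_insert, Ideal.span_insert, ← sup_assoc]
    · have := Finset.card_insert_le w S
      omega

theorem colength_lt {A B : Ideal R} (hA : Module.length R (R ⧸ A) ≠ ⊤) (hAB : A < B) :
    colength B < colength A := by
  obtain ⟨S, -, hBS, hS⟩ := exists_finset_generators hA hAB.le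
  have : S.card ≠ 0 := by
    rw [Finset.card_ne_zero, Finset.nonempty_iff_ne_empty]
    rintro rfl
    exact hAB.not_ge (by simpa using hBS)
  omega

theorem colength_le {A B : Ideal R} (hA : Module.length R (R ⧸ A) ≠ ⊤) (hAB : A ≤ B) :
    colength B ≤ colength A := by
  obtain ⟨S, -, -, hS⟩ := exists_finset_generators hA hAB
  omega

theorem IsMPrimary.length_ne_top_of_pow_le [IsLocalRing R] [IsNoetherianRing R] {I : Ideal R}
    (hI : IsMPrimary I) {A : Ideal R} {n : ℕ} (h : I ^ n ≤ A) : Module.length R (R ⧸ A) ≠ ⊤ :=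
  ne_top_of_le_ne_top (hI.pow n.succ_ne_zero).length_ne_top
    (Module.length_le_of_surjective
      (Submodule.factor ((Ideal.pow_le_pow_right n.le_succ).trans h))
      (Submodule.factor_surjective _))

end Length

/-! ### The saturated filtration. -/

section Filtration

variable {R : Type*} [CommRing R] {I : Ideal R} {x : R}

/-- The filtration `⋃ₖ (I ^ (n + k) : x ^ k)`; it is the Ratliff-Rush filtration of `I` when `x` is
superficial. -/
def saturatedPow (I : Ideal R) {x : R} (hx : x ∈ I) (n : ℕ) : Ideal R where
  carrier := {z | ∃ k, x ^ k * z ∈ I ^ (n + k)}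
  zero_mem' := ⟨0, by simp⟩
  add_mem' := by
    rintro z w ⟨k, hz⟩ ⟨l, hw⟩
    refine ⟨k + l, ?_⟩
    have h1 := Ideal.mul_mem_mul hz (Ideal.pow_mem_pow hx l)
    have h2 := Ideal.mul_mem_mul hw (Ideal.pow_mem_pow hx k)
    rw [← pow_add] at h1 h2
    rw [show x ^ (k + l) * (z + w) = x ^ k * z * x ^ l + x ^ l * w * x ^ k by ring]
    exact add_mem (by rwa [← add_assoc]) (by rwa [add_comm k, ← add_assoc])
  smul_mem' := by
    rintro r z ⟨k, hz⟩
    exact ⟨k, by rw [smul_eq_mul, mul_left_comm]; exact Ideal.mul_mem_left _ _ hz⟩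

theorem mem_saturatedPow (hx : x ∈ I) {n : ℕ} {z : R} :
    z ∈ saturatedPow I hx n ↔ ∃ k, x ^ k * z ∈ I ^ (n + k) := Iff.rfl

theorem pow_le_saturatedPow (hx : x ∈ I) (n : ℕ) : I ^ n ≤ saturatedPow I hx n :=
  fun z hz => ⟨0, by simpa using hz⟩

theorem saturatedPow_zero (hx : x ∈ I) : saturatedPow I hx 0 = ⊤ :=
  top_le_iff.1 (by simpa using pow_le_saturatedPow hx 0)

theorem mul_saturatedPow_le (hx : x ∈ I) (n : ℕ) :
    I * saturatedPow I hx n ≤ saturatedPow I hx (n + 1) := by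
  refine Ideal.mul_le.2 fun a ha z ⟨k, hz⟩ => ⟨k, ?_⟩
  rw [mul_left_comm, add_right_comm, pow_succ']
  exact Ideal.mul_mem_mul ha hz

/-- The reason for saturating: the colon by `x` is exact in every degree, whereas superficiality
gives this for the powers of `I` only in large degrees. -/
theorem mul_mem_saturatedPow_succ (hx : x ∈ I) {n : ℕ} {z : R} :
    x * z ∈ saturatedPow I hx (n + 1) ↔ z ∈ saturatedPow I hx n := by
  refine ⟨fun ⟨k, hz⟩ => ⟨k + 1, ?_⟩, fun h => mul_saturatedPow_le hx n (Ideal.mul_mem_mul hx h)⟩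
  rwa [pow_succ, mul_assoc, add_comm k, ← add_assoc]

theorem saturatedPow_eq_pow (hx : x ∈ I) {n₀ : ℕ}
    (h : ∀ n ≥ n₀, ∀ z, x * z ∈ I ^ (n + 1) → z ∈ I ^ n) {n : ℕ} (hn : n₀ ≤ n) :
    saturatedPow I hx n = I ^ n := by
  refine le_antisymm (fun z ⟨k, hz⟩ => ?_) (pow_le_saturatedPow hx n)
  induction k with
  | zero => simpa using hz
  | succ k ih =>
    refine ih (h (n + k) (by omega) _ ?_)
    rwa [← mul_assoc, ← pow_succ']

end Filtration

/-! ### Hilbert coefficients from second differences, and the final count. -/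

section Main

variable {R : Type*} [CommRing R]

theorem hilbertSum_two (e : Fin 3 → ℤ) (n : ℕ) :
    hilbertSum 2 e n = e 0 * ((n + 1).choose 2 : ℤ) - e 1 * n + e 2 := by
  simp [hilbertSum, Fin.sum_univ_three]
  ring

/-- A sequence whose second differences are `e₀ - wₙ`, with `wₙ = 0` for `n ≥ N`, is eventually
the expected polynomial. -/
theorem exists_eq_hilbertSum {h w : ℕ → ℤ} {e₀ : ℤ} {N : ℕ} (h0 : h 0 = 0) (h1 : h 1 = e₀ - w 0)
    (h2 : ∀ n, h (n + 2) + h n + w (n + 1) = e₀ + 2 * h (n + 1)) (hw : ∀ n ≥ N, w n = 0) :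
    ∃ e₂ : ℤ, ∀ n ≥ N, h n = hilbertSum 2 ![e₀, ∑ i ∈ Finset.range N, w i, e₂] n := by
  have hdiff : ∀ n, h (n + 1) - h n = (n + 1) * e₀ - ∑ i ∈ Finset.range (n + 1), w i := by
    intro n
    induction n with
    | zero => simp [h0, h1]
    | succ n ih =>
      rw [Finset.sum_range_succ]
      push_cast
      linear_combination h2 n + ih
  have hsum : ∀ n ≥ N, ∑ i ∈ Finset.range n, w i = ∑ i ∈ Finset.range N, w i := by
    intro n hn
    induction n, hn using Nat.le_induction with
    | base => rfl
    | succ n hn ih => rw [Finset.sum_range_succ, ih, hw n hn, add_zero]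
  -- The constant term is chosen to make the formula true at `n = N`; the first differences then
  -- propagate it.
  refine ⟨h N - (e₀ * ((N + 1).choose 2 : ℤ) - (∑ i ∈ Finset.range N, w i) * N), fun n hn => ?_⟩
  simp only [hilbertSum_two, Matrix.cons_val]
  induction n, hn using Nat.le_induction with
  | base => ring
  | succ n hn ih =>
    have h3 := hdiff n
    rw [hsum _ (by omega)] at h3
    have h4 : ((n + 1 + 1).choose 2 : ℤ) = (n + 1) + ((n + 1).choose 2 : ℤ) := by
      rw [Nat.choose_succ_succ]
      push_cast
      simp
    rw [h4]
    push_cast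
    linear_combination h3 + ih

end Main
end RossiBound

theorem mainTheorem4 {R : Type*} [CommRing R] [IsLocalRing R]
    [RossiBound.IsCohenMacaulayLocalRing R] [Infinite (IsLocalRing.ResidueField R)]
    (hdim : ringKrullDim R = 2) (I J : Ideal R) (hI : RossiBound.IsMPrimary I)
    (hJ : RossiBound.IsMinimalReduction J I) :
    RossiBound.IsHilbertCoeffs I 2 (RossiBound.hilbertCoeff I 2) ∧
      (RossiBound.reductionNumber J I : ℤ) ≤
        RossiBound.hilbertCoeff I 2 1 - RossiBound.hilbertCoeff I 2 0 +
          (RossiBound.colength I : ℤ) + 1 := by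
  classical
  open RossiBound in
  obtain ⟨x, y, hJxy, hx, hy, n₀, hn₀⟩ := hJ.exists_generators hdim hI
  have hJI : J ≤ I := hJ.1.1
  obtain ⟨r, hr⟩ := hJ.1.2
  have hxI : x ∈ I := hJI (hJxy ▸ Ideal.subset_span (by simp))
  have hyI : y ∈ I := hJI (hJxy ▸ Ideal.subset_span (by simp))
  set F := saturatedPow I hxI with hFdef
  have hIF : ∀ n, I ^ n ≤ F n := pow_le_saturatedPow hxI
  have hmulF : ∀ n, I * F n ≤ F (n + 1) := mul_saturatedPow_le hxI
  have hpow : ∀ n, I ^ (n + r + 1) = J * I ^ (n + r) := fun n => by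
    rw [add_assoc, pow_add, hr, mul_left_comm, ← pow_add]
  -- From here on `F n = I ^ n` and `J F n = F (n + 1)`. The extra `1` ensures `s < N`, since `s ≤
  -- r`.
  set N := n₀ + r + 1 with hN
  have hFpow : ∀ n ≥ n₀, F n = I ^ n := fun n hn => saturatedPow_eq_pow hxI hn₀ hn
  have hFfin : ∀ n, Module.length R (R ⧸ F n) ≠ ⊤ := fun n => hI.length_ne_top_of_pow_le (hIF n)
  have hJFfin : ∀ n, Module.length R (R ⧸ J * F n) ≠ ⊤ := fun n => by
    refine hI.length_ne_top_of_pow_le (n := n + r + 1) ?_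
    rw [hpow]
    exact Ideal.mul_mono_right ((Ideal.pow_le_pow_right (by omega)).trans (hIF n))
  have hF0 : F 0 = ⊤ := saturatedPow_zero hxI
  have hJF0 : J * F 0 = J := by rw [hF0, Ideal.mul_top]
  have hJfin : Module.length R (R ⧸ J) ≠ ⊤ := hJF0 ▸ hJFfin 0
  set w : ℕ → ℤ := fun n => colength (J * F n) - colength (F (n + 1)) with hw
  have hwN : ∀ n ≥ N, w n = 0 := by
    intro n hn
    have : J * F n = F (n + 1) := by
      rw [hFpow n (by omega), hFpow (n + 1) (by omega)]
      obtain ⟨k, rfl⟩ := Nat.exists_eq_add_of_le' (show r ≤ n by omega)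
      exact (hpow k).symm
    simp [hw, this]
  obtain ⟨e₂, he⟩ := exists_eq_hilbertSum (h := fun n => (colength (F n) : ℤ)) (w := w)
    (e₀ := colength J) (N := N) (by simp [hF0, colength]) (by simp [hw, hF0]) (fun n => by
      have h1 := length_quotient_span_pair_mul hx hy (F := F (n + 1)) fun z hz =>
        hmulF n (Ideal.mul_mem_mul hyI ((mul_mem_saturatedPow_succ hxI).1 hz))
      have h2 : (F (n + 1)).colon {x} = F n := by
        ext z
        rw [Submodule.mem_colon_singleton, smul_eq_mul, mul_comm]
        exact mul_mem_saturatedPow_succ hxI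
      rw [h2, ← hJxy, two_mul] at h1
      have h3 := congrArg ENat.toNat h1
      rw [ENat.toNat_add (hJFfin _) (hFfin _), ENat.toNat_add hJfin (by simp [hFfin]),
        ENat.toNat_add (hFfin _) (hFfin _)] at h3
      have h4 : w (n + 1) = colength (J * F (n + 1)) - colength (F (n + 2)) := rfl
      rw [h4]
      simp only [colength]
      omega) hwN
  set e : Fin 3 → ℤ := ![(colength J : ℤ), ∑ i ∈ Finset.range N, w i, e₂] with hedef
  have hH : IsHilbertCoeffs I 2 e := by
    refine eventually_atTop.2 ⟨N, fun n hn => ?_⟩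
    rw [← hFpow n (by omega)]
    exact ⟨hFfin n, he n hn⟩
  rw [hH.hilbertCoeff_eq]
  refine ⟨hH, ?_⟩
  -- Minimality of `s` makes `(I ^ (n + 1) + J F n) / J F n` nonzero for every `n < s`.
  have hex : ∃ s, I ^ (s + 1) ≤ J * F s := ⟨r, by rw [hr]; exact Ideal.mul_mono_right (hIF r)⟩
  set s := Nat.find hex with hs
  have hsN : s < N := lt_of_le_of_lt
    (Nat.find_min' hex (by rw [hr]; exact Ideal.mul_mono_right (hIF r))) (by omega)
  have hJF : ∀ n, J * F n ≤ F (n + 1) := fun n => (Ideal.mul_mono_left hJI).trans (hmulF n)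
  have hAfin : ∀ n, Module.length R (R ⧸ (I ^ (n + 1) ⊔ J * F n)) ≠ ⊤ :=
    fun n => hI.length_ne_top_of_pow_le le_sup_left
  choose S hSF hFS hS using fun n => exists_finset_generators (hAfin n)
    (sup_le (hIF (n + 1)) (hJF n))
  have hred := pow_succ_eq_mul_pow_of_generators (ι := Σ i : Fin N, S i) hJI
    (d := fun i => i.1 + 1) (m := fun i => i.2) (F := F) hmulF (fun i => hSF _ _ i.2.2) (fun n => by
      rcases lt_or_ge n N with hn | hn
      · refine (hFS n).trans (sup_le_sup_left (Ideal.span_mono fun z hz => ?_) _)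
        exact ⟨⟨⟨n, hn⟩, ⟨z, hz⟩⟩, rfl, rfl⟩
      · rw [hFpow (n + 1) (by omega), sup_assoc]
        exact le_sup_left) (Nat.find_spec hex)
  have hle : reductionNumber J I ≤ s + Fintype.card (Σ i : Fin N, S i) := Nat.sInf_le hred
  have hcard : Fintype.card (Σ i : Fin N, S i) = ∑ i ∈ Finset.range N, (S i).card := by
    rw [Fintype.card_sigma, Finset.sum_range]
    simp
  -- Degree zero contributes `λ(I / J)` exactly, and each later degree below `s` contributes at
  -- least one; the `- 1` records that degree zero is not counted among the latter.
  have hbound : ∀ M, (∑ i ∈ Finset.range (M + 1), (S i).card : ℤ) + min (M + 1) s - 1 ≤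
      colength I - colength J + ∑ i ∈ Finset.range (M + 1), w i := by
    intro M
    induction M with
    | zero =>
      have h1 := hS 0
      rw [zero_add, pow_one, hF0, Ideal.mul_top, sup_eq_left.2 hJI] at h1
      simp only [zero_add, Finset.sum_range_one, hw, hF0, Ideal.mul_top]
      omega
    | succ M ih =>
      have h1 := hS (M + 1)
      rw [Finset.sum_range_succ, Finset.sum_range_succ (f := w)]
      have h2 := colength_le (hJFfin (M + 1)) (le_sup_right : _ ≤ I ^ (M + 1 + 1) ⊔ J * F (M + 1))
      have h3 : M + 1 < s → colength (I ^ (M + 1 + 1) ⊔ J * F (M + 1)) <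
          colength (J * F (M + 1)) := fun h => by
        refine colength_lt (hJFfin _) (lt_of_le_of_ne le_sup_right fun heq => ?_)
        exact Nat.find_min hex h (heq ▸ le_sup_left)
      have h4 : w (M + 1) = colength (J * F (M + 1)) - colength (F (M + 1 + 1)) := rfl
      push_cast
      omega
  have hfin := hbound (n₀ + r)
  have he0 : e 0 = colength J := rfl
  have he1 : e 1 = ∑ i ∈ Finset.range N, w i := rfl
  rw [he0, he1]
  have hcard' : (Fintype.card (Σ i : Fin N, S i) : ℤ) = ∑ i ∈ Finset.range N, ((S i).card : ℤ) := by
    rw [hcard]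
    push_cast
    rfl
  rw [← hN] at hfin
  omega
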